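/- Let $k$ be an algebraically closed field of characteristic $0$, and for every integer $m\ge 1$ fix a primitive $m$-th root of unity $\zeta_m\in k$. For $m\ge 1$ and an integer $e$ with $\gcd(e,m)=1$, let $Q(m,e)$ be the unital associative $k$-algebra with generators $x_1,x_1^{-1},x_2,x_2^{-1}$ and relations $x_ix_i^{-1}=x_i^{-1}x_i=1$ ($i=1,2$) and $x_2x_1=\zeta_m^{e}x_1x_2$, with its $\mathbb Z^2$-grading $Q(m,e)^{(a,b)}=k\,x_1^{a}x_2^{b}$. Let $\Lambda$ be a free abelian group of finite rank $n\ge 1$, and let $B=\bigoplus_{\lambda\in\Lambda}B^\lambda$ be an associative $\Lambda$-torus, i.e. a unital associative $\Lambda$-graded $k$-algebra such that each nonzero $B^\lambda$ is spanned over $k$ by an invertible element of $B$ and such that $\{\lambda\in\Lambda : B^\lambda\ne 0\}$ generates the group $\Lambda$. Suppose that $B$ is fgc, i.e. finitely generated as a module over its centroid (the algebra of all $k$-linear endomorphisms of $B$ that commute with all left and right multiplications by elements of $B$). Then there are integers $r,s\ge 0$ with $n=2r+s$, integers $m_1,\dots,m_r\ge 2$ with $m_1\mid m_2\mid\dots\mid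 m_r$, and integers $e_1,\dots,e_r$ with $\gcd(e_i,m_i)=1$ for all $i$, such that $B$ is isograded-isomorphic to $$T:=Q(m_1,e_1)\otimes_k\dots\otimes_k Q(m_r,e_r)\otimes_k k[z_1^{\pm1},\dots,z_s^{\pm1}],$$ where $k[z_1^{\pm1},\dots,z_s^{\pm1}]$ has its natural $\mathbb Z^s$-grading and $T$ has the resulting natural grading by $(\mathbb Z^2)^r\oplus\mathbb Z^s$. That is, there are a $k$-algebra isomorphism $\varphi:B\to T$ and a group isomorphism $\nu:\Lambda\to(\mathbb Z^2)^r\oplus\mathbb Z^s$ with $\varphi(B^\lambda)=T^{\nu(\lambda)}$ for all $\lambda\in\Lambda$. -/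

import Mathlib

open scoped TensorProduct

noncomputable section

namespace AssocTori

/-! ### Centroid and fgc algebras -/

section Centroid

variable (k B : Type*) [Field k] [Ring B] [Algebra k B]

/-- The multiplication algebra: the unital subalgebra of `End_k(B)` generated by all left and right
multiplication operators. -/
def multAlgebra : Subalgebra k (Module.End k B) :=
  Algebra.adjoin k
    (Set.range (LinearMap.mulLeft k : B → Module.End k B) ∪
      Set.range (LinearMap.mulRight k : B → Module.End k B))

/-- The centroid: the centralizer of the multiplication algebra in `End_k(B)`. -/
def centroid : Subalgebra k (Module.End k B) :=
  Subalgebra.centralizer k (multAlgebra k B : Set (Module.End k B))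

/-- An algebra is fgc if it is finitely generated as a module over its centroid. -/
def IsFgc : Prop := Module.Finite (centroid k B) B

end Centroid

/-! ### Graded algebras -/

section Graded

variable {k : Type*} [Field k]

/-- The support of a family of homogeneous components. -/
def gradedSupport {Λ B : Type*} [Ring B] [Algebra k B] (𝓑 : Λ → Submodule k B) : Set Λ :=
  {l | 𝓑 l ≠ ⊥}

/-- Associative `Λ`-tori (among unital associative `Λ`-graded algebras): every nonzero homogeneous
component is spanned by an invertible element, and the support generates `Λ`. -/
structure IsAssocTorus {Λ B : Type*} [AddCommGroup Λ] [DecidableEq Λ] [Ring B] [Algebra k B]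
    (𝓑 : Λ → Submodule k B) [GradedAlgebra 𝓑] : Prop where
  spanned_by_unit : ∀ l ∈ gradedSupport 𝓑, ∃ u : Bˣ, 𝓑 l = Submodule.span k {(u : B)}
  closure_support : AddSubgroup.closure (gradedSupport 𝓑) = ⊤

/-- Isograded-isomorphism: an algebra isomorphism `φ` and an isomorphism `ν` of the grading groups
such that `φ` maps the component of degree `l` onto the component of degree `ν l`. -/
def IsogradedIso {Λ Λ' B B' : Type*} [AddCommGroup Λ] [AddCommGroup Λ']
    [Semiring B] [Algebra k B] [Semiring B'] [Algebra k B']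
    (𝓑 : Λ → Submodule k B) (𝓑' : Λ' → Submodule k B') : Prop :=
  ∃ (φ : B ≃ₐ[k] B') (ν : Λ ≃+ Λ'), ∀ l : Λ, (𝓑 l).map φ.toLinearMap = 𝓑' (ν l)

/-- The grading of a binary tensor product: the component of degree `(g, h)` is spanned by the
`a ⊗ b` with `a` of degree `g` and `b` of degree `h`. -/
def tensorGrading {G H A B : Type*} [Semiring A] [Algebra k A] [Semiring B] [Algebra k B]
    (𝓐 : G → Submodule k A) (𝓑 : H → Submodule k B) : G × H → Submodule k (A ⊗[k] B) :=
  fun p => Submodule.span k {t | ∃ a ∈ 𝓐 p.1, ∃ b ∈ 𝓑 p.2, t = a ⊗ₜ[k] b}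

/-- The grading of a finite tensor product: the component of degree `(g i)ᵢ` is spanned by the pure
tensors whose `i`-th factor has degree `g i`. -/
def piTensorGrading {ι : Type*} {G A : ι → Type*} [∀ i, Semiring (A i)] [∀ i, Algebra k (A i)]
    (𝓐 : ∀ i, G i → Submodule k (A i)) : (∀ i, G i) → Submodule k (⨂[k] i, A i) :=
  fun g => Submodule.span k
    {t | ∃ a : ∀ i, A i, (∀ i, a i ∈ 𝓐 i (g i)) ∧ t = PiTensorProduct.tprod k a}

end Graded

/-! ### The quantum torus in two variables -/

/-- The names of the generators `x₁, x₁⁻¹, x₂, x₂⁻¹`. -/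
inductive QGen : Type
  | x₁ | x₁inv | x₂ | x₂inv

section Quantum

variable {k : Type*} [Field k]

/-- The relations `xᵢ xᵢ⁻¹ = xᵢ⁻¹ xᵢ = 1` and `x₂ x₁ = q x₁ x₂`. -/
inductive QRel (q : k) : FreeAlgebra k QGen → FreeAlgebra k QGen → Prop
  | x₁_mul_inv : QRel q (FreeAlgebra.ι k QGen.x₁ * FreeAlgebra.ι k QGen.x₁inv) 1
  | x₁_inv_mul : QRel q (FreeAlgebra.ι k QGen.x₁inv * FreeAlgebra.ι k QGen.x₁) 1
  | x₂_mul_inv : QRel q (FreeAlgebra.ι k QGen.x₂ * FreeAlgebra.ι k QGen.x₂inv) 1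
  | x₂_inv_mul : QRel q (FreeAlgebra.ι k QGen.x₂inv * FreeAlgebra.ι k QGen.x₂) 1
  | comm : QRel q (FreeAlgebra.ι k QGen.x₂ * FreeAlgebra.ι k QGen.x₁)
      (q • (FreeAlgebra.ι k QGen.x₁ * FreeAlgebra.ι k QGen.x₂))

/-- The quantum torus of the matrix with rows `(1, q)` and `(q⁻¹, 1)`, where `q ≠ 0`: the unital
associative algebra with the above generators and relations. -/
abbrev QuantumTorus (q : k) : Type _ := RingQuot (QRel q)

namespace QuantumTorus

/-- The image of a generator. -/
def gen (q : k) (g : QGen) : QuantumTorus q := RingQuot.mkAlgHom k (QRel q) (FreeAlgebra.ι k g)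

/-- The invertible element `x₁`. -/
def x₁ (q : k) : (QuantumTorus q)ˣ where
  val := gen q QGen.x₁
  inv := gen q QGen.x₁inv
  val_inv := by
    simpa [gen] using RingQuot.mkAlgHom_rel k (QRel.x₁_mul_inv (q := q))
  inv_val := by
    simpa [gen] using RingQuot.mkAlgHom_rel k (QRel.x₁_inv_mul (q := q))

/-- The invertible element `x₂`. -/
def x₂ (q : k) : (QuantumTorus q)ˣ where
  val := gen q QGen.x₂
  inv := gen q QGen.x₂inv
  val_inv := by
    simpa [gen] using RingQuot.mkAlgHom_rel k (QRel.x₂_mul_inv (q := q))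
  inv_val := by
    simpa [gen] using RingQuot.mkAlgHom_rel k (QRel.x₂_inv_mul (q := q))

/-- The natural `ℤ²`-grading: the component of degree `(a, b)` is `k x₁ᵃ x₂ᵇ`. -/
def grading (q : k) : ℤ × ℤ → Submodule k (QuantumTorus q) :=
  fun l => Submodule.span k {((x₁ q ^ l.1 * x₂ q ^ l.2 : (QuantumTorus q)ˣ) : QuantumTorus q)}

end QuantumTorus

end Quantum

/-- The algebra `k[z₁^{±1}, …, z_s^{±1}]` of Laurent polynomials, as the group algebra of `ℤˢ`. -/
abbrev LaurentAlg (k : Type*) [Field k] (s : ℕ) : Type _ := AddMonoidAlgebra k (Fin s → ℤ)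

/-- The natural `ℤˢ`-grading of the Laurent polynomials. -/
abbrev laurentGrading (k : Type*) [Field k] (s : ℕ) :
    (Fin s → ℤ) → Submodule k (LaurentAlg k s) :=
  AddMonoidAlgebra.grade k

end AssocTori

end

/-! The homogeneous units of `B` commute up to scalars, and these scalars form an alternating
bimultiplicative map `c : Λ × Λ → kˣ`. A centroid element is multiplication by a central element,
and central elements live in degrees in the radical of `c`. So fgc forces the radical to have finite
index (`finiteIndex_radical`), and `c` takes values in the `N`-th roots of unity for some `N`.

Hence `c = ξ ^ F` for an integral alternating form `F` (`exists_integral_lift`). Splitting off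
hyperbolic planes gives a symplectic normal form of `F` modulo `N`
(`exists_symplectic_coordinates_mod`), and the part where `F` vanishes modulo `N` supplies the
Laurent variables.

It remains to see that `c` determines `B`. In the new coordinates the cocycle `ω` of the model
algebra has commutator `c`. Dividing the product of homogeneous units by `ω` makes them an abelian
group mapping onto the free group `Λ`; a splitting is a basis of `B` with the structure constants of
the model (`exists_section_of_cocycle`). -/

noncomputable section

namespace AssocTori

/-! ### Scalars as central units -/

section Scalars

variable {k B : Type*} [Field k] [Ring B] [Algebra k B]

/-- The scalars as invertible elements of `B`. -/
def scalarUnit (B : Type*) [Ring B] [Algebra k B] : kˣ →* Bˣ :=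
  Units.map (algebraMap k B).toMonoidHom

theorem val_scalarUnit_mul (a : kˣ) (u : Bˣ) :
    ((scalarUnit B a * u : Bˣ) : B) = (a : k) • (u : B) := by
  simp [scalarUnit, Algebra.smul_def]

theorem scalarUnit_commute (a : kˣ) (u : Bˣ) : Commute (scalarUnit B a) u := by
  ext
  simpa [scalarUnit] using Algebra.commutes _ _

end Scalars

/-! ### Monomial basis of the quantum torus -/

namespace QuantumTorus

variable {k : Type*} [Field k]

/-- The monomial `x₁ᵃ x₂ᵇ`. -/
def monomial (q : k) (l : ℤ × ℤ) : (QuantumTorus q)ˣ := x₁ q ^ l.1 * x₂ q ^ l.2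

/-- The shift in the first variable on functions on `ℤ²`. -/
def shiftOne (k : Type*) [Field k] (m : ℤ) : Module.End k (ℤ × ℤ → k) where
  toFun f p := f (p.1 - m, p.2)
  map_add' _ _ := rfl
  map_smul' _ _ := rfl

/-- The twisted shift in the second variable on functions on `ℤ²`. -/
def shiftTwo (q : k) (n : ℤ) : Module.End k (ℤ × ℤ → k) where
  toFun f p := q ^ (n * p.1) * f (p.1, p.2 - n)
  map_add' _ _ := by ext; simp [mul_add]
  map_smul' _ _ := by ext; simp [mul_left_comm]

theorem shiftOne_mul (m m' : ℤ) : shiftOne k m * shiftOne k m' = shiftOne k (m + m') := by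
  ext f p; simp [shiftOne, sub_sub]

theorem shiftOne_zero : shiftOne k 0 = 1 := by
  ext f p; simp [shiftOne]

theorem shiftTwo_mul {q : k} (hq : q ≠ 0) (n n' : ℤ) :
    shiftTwo q n * shiftTwo q n' = shiftTwo q (n + n') := by
  ext f p; simp [shiftTwo, sub_sub, add_mul, zpow_add₀ hq, mul_assoc]

theorem shiftTwo_zero (q : k) : shiftTwo q 0 = 1 := by
  ext f p; simp [shiftTwo]

theorem shiftTwo_mul_shiftOne {q : k} (hq : q ≠ 0) :
    shiftTwo q 1 * shiftOne k 1 = q • (shiftOne k 1 * shiftTwo q 1) := by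
  ext f p
  simp only [shiftTwo, shiftOne, Module.End.mul_apply, LinearMap.coe_mk, AddHom.coe_mk,
    LinearMap.smul_apply, Pi.smul_apply, smul_eq_mul, one_mul, ← mul_assoc]
  rw [zpow_sub_one₀ hq, mul_comm q, inv_mul_cancel_right₀ hq]

/-- The images of the generators in the representation by shifts. -/
def shiftGen (q : k) : QGen → Module.End k (ℤ × ℤ → k)
  | .x₁ => shiftOne k 1
  | .x₁inv => shiftOne k (-1)
  | .x₂ => shiftTwo q 1
  | .x₂inv => shiftTwo q (-1)

/-- The representation of the quantum torus by shifts on functions on `ℤ²`. -/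
def shiftRep {q : k} (hq : q ≠ 0) : QuantumTorus q →ₐ[k] Module.End k (ℤ × ℤ → k) :=
  RingQuot.liftAlgHom k ⟨FreeAlgebra.lift k (shiftGen q), by
    intro x y h
    induction h <;>
      simp [shiftGen, shiftOne_mul, shiftTwo_mul hq, shiftOne_zero, shiftTwo_zero,
        shiftTwo_mul_shiftOne hq]⟩

theorem shiftRep_gen {q : k} (hq : q ≠ 0) (g : QGen) : shiftRep hq (gen q g) = shiftGen q g := by
  simp [shiftRep, gen, RingQuot.liftAlgHom_mkAlgHom_apply]

theorem shiftRep_x₁_zpow {q : k} (hq : q ≠ 0) (m : ℤ) :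
    shiftRep hq ((x₁ q ^ m : (QuantumTorus q)ˣ) : QuantumTorus q) = shiftOne k m := by
  induction m using Int.induction_on with
  | zero => simp [shiftOne_zero]
  | succ i ih =>
    rw [zpow_add_one, Units.val_mul, map_mul, ih, ← shiftOne_mul]
    exact congrArg _ (shiftRep_gen hq _)
  | pred i ih =>
    rw [zpow_sub_one, Units.val_mul, map_mul, ih, sub_eq_add_neg, ← shiftOne_mul]
    exact congrArg _ (shiftRep_gen hq _)

theorem shiftRep_x₂_zpow {q : k} (hq : q ≠ 0) (m : ℤ) :
    shiftRep hq ((x₂ q ^ m : (QuantumTorus q)ˣ) : QuantumTorus q) = shiftTwo q m := by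
  induction m using Int.induction_on with
  | zero => simp [shiftTwo_zero]
  | succ i ih =>
    rw [zpow_add_one, Units.val_mul, map_mul, ih, ← shiftTwo_mul hq]
    exact congrArg _ (shiftRep_gen hq _)
  | pred i ih =>
    rw [zpow_sub_one, Units.val_mul, map_mul, ih, sub_eq_add_neg, ← shiftTwo_mul hq]
    exact congrArg _ (shiftRep_gen hq _)

theorem shiftRep_monomial {q : k} (hq : q ≠ 0) (l : ℤ × ℤ) :
    shiftRep hq (monomial q l : QuantumTorus q) (Pi.single 0 1) = Pi.single l 1 := by
  rw [monomial, Units.val_mul, map_mul, shiftRep_x₁_zpow, shiftRep_x₂_zpow]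
  ext p
  by_cases h : p = l
  · subst h
    simp [shiftOne, shiftTwo, ← Prod.zero_eq_mk]
  · have : (p.1 - l.1, p.2 - l.2) ≠ 0 := by
      contrapose! h
      simpa [Prod.ext_iff, sub_eq_zero] using h
    simp only [shiftOne, shiftTwo, Module.End.mul_apply, LinearMap.coe_mk, AddHom.coe_mk,
      Pi.single_apply, this, h, if_false, mul_zero]

/-- The shift representation sends the delta function at the origin to a different delta function
for each monomial, so the presentation hides no linear relation. -/
theorem linearIndependent_monomial {q : k} (hq : q ≠ 0) :
    LinearIndependent k fun l => (monomial q l : QuantumTorus q) := by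
  refine LinearIndependent.of_comp
    ((LinearMap.applyₗ (Pi.single 0 1 : ℤ × ℤ → k)).comp (shiftRep hq).toLinearMap) ?_
  convert Pi.linearIndependent_single_one (ℤ × ℤ) k using 1
  ext1 l
  exact shiftRep_monomial hq l

/-- Conjugation by `x⁻¹` multiplies `y` by the central `c`, hence `y ^ n` by `c ^ n`. Read
backwards, conjugation by `y ^ n` multiplies `x` by `c ^ n`, hence `x ^ m` by `c ^ (n * m)`. -/
theorem zpow_mul_zpow_of_mul_eq_central_mul {G : Type*} [Group G] {c x y : G}
    (hc : ∀ z, Commute c z) (h : y * x = c * (x * y)) (m n : ℤ) :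
    y ^ n * x ^ m = c ^ (n * m) * (x ^ m * y ^ n) := by
  have h2 : SemiconjBy x⁻¹ y (c * y) := by
    rw [SemiconjBy, inv_mul_eq_iff_eq_mul, ← mul_assoc, eq_mul_inv_iff_mul_eq, h, ← mul_assoc,
      ← mul_assoc, (hc x).eq]
  have h3 : SemiconjBy x⁻¹ (y ^ n) (c ^ n * y ^ n) := by
    rw [← (hc y).mul_zpow]; exact h2.zpow_right n
  have h4 : SemiconjBy (y ^ n) x (c ^ n * x) := by
    have := h3.eq
    rw [inv_mul_eq_iff_eq_mul, ← mul_assoc, eq_mul_inv_iff_mul_eq] at this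
    rw [SemiconjBy, this, ← mul_assoc, ((hc x).zpow_left n).eq]
  have h5 : SemiconjBy (y ^ n) (x ^ m) ((c ^ n) ^ m * x ^ m) := by
    rw [← ((hc x).zpow_left n).mul_zpow]; exact h4.zpow_right m
  rw [h5.eq, zpow_mul, mul_assoc]

theorem x₂_mul_x₁ (q : k) :
    (x₂ q * x₁ q : QuantumTorus q) = q • (x₁ q * x₂ q : QuantumTorus q) := by
  simpa [gen, x₁, x₂] using RingQuot.mkAlgHom_rel k (QRel.comm (q := q))

theorem monomial_mul (q : kˣ) (g h : ℤ × ℤ) :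
    (monomial (q : k) g * monomial (q : k) h : QuantumTorus (q : k)) =
      ((q ^ (g.2 * h.1) : kˣ) : k) • (monomial (q : k) (g + h) : QuantumTorus (q : k)) := by
  have h1 : x₂ (q : k) * x₁ (q : k) = scalarUnit _ q * (x₁ (q : k) * x₂ (q : k)) := by
    ext
    rw [val_scalarUnit_mul]
    exact x₂_mul_x₁ _
  have key := zpow_mul_zpow_of_mul_eq_central_mul (scalarUnit_commute q) h1 h.1 g.2
  rw [← val_scalarUnit_mul, ← Units.val_mul]
  congr 1
  simp only [monomial, map_zpow, Prod.fst_add, Prod.snd_add, zpow_add]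
  rw [mul_assoc, ← mul_assoc (x₂ _ ^ _), key, mul_assoc, mul_assoc,
    ← mul_assoc (x₁ _ ^ _) (scalarUnit _ q ^ _),
    ← ((scalarUnit_commute q _).zpow_left _).eq]
  simp only [mul_assoc]

theorem monomial_zero (q : k) : monomial q 0 = 1 := by simp [monomial]

/-- By `monomial_mul` the span is closed under multiplication, and it contains 1 and the four
generators. -/
theorem span_range_monomial (q : kˣ) :
    Submodule.span k (Set.range fun l => (monomial (q : k) l : QuantumTorus (q : k))) = ⊤ := by
  set S := Submodule.span k (Set.range fun l => (monomial (q : k) l : QuantumTorus (q : k))) with hS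
  have hmem (l) : (monomial (q : k) l : QuantumTorus (q : k)) ∈ S := Submodule.subset_span ⟨l, rfl⟩
  have hmul : ∀ a ∈ S, ∀ b ∈ S, a * b ∈ S := by
    intro a ha b hb
    have := Submodule.mul_mem_mul ha hb
    rw [hS, Submodule.span_mul_span] at this
    refine Submodule.span_le.2 ?_ this
    rintro _ ⟨_, ⟨g, rfl⟩, _, ⟨h, rfl⟩, rfl⟩
    simp only [monomial_mul]
    exact S.smul_mem _ (hmem _)
  have hone : (1 : QuantumTorus (q : k)) ∈ S := by simpa [monomial_zero] using hmem 0
  rw [eq_top_iff]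
  rintro x -
  obtain ⟨x, rfl⟩ := RingQuot.mkAlgHom_surjective k (QRel (q : k)) x
  induction x using FreeAlgebra.induction with
  | grade0 r =>
    rw [AlgHom.commutes, Algebra.algebraMap_eq_smul_one]
    exact S.smul_mem _ hone
  | grade1 g =>
    cases g
    · exact show (x₁ (q : k) : (QuantumTorus (q : k))ˣ).val ∈ S by simpa [monomial] using hmem (1, 0)
    · exact show ((x₁ (q : k))⁻¹ : (QuantumTorus (q : k))ˣ).val ∈ S by simpa [monomial] using hmem (-1, 0)
    · exact show (x₂ (q : k) : (QuantumTorus (q : k))ˣ).val ∈ S by simpa [monomial] using hmem (0, 1)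
    · exact show ((x₂ (q : k))⁻¹ : (QuantumTorus (q : k))ˣ).val ∈ S by simpa [monomial] using hmem (0, -1)
  | mul a b ha hb => rw [map_mul]; exact hmul _ ha _ hb
  | add a b ha hb => rw [map_add]; exact S.add_mem ha hb

/-- The basis of monomials. -/
def monomialBasis (q : kˣ) : Module.Basis (ℤ × ℤ) k (QuantumTorus (q : k)) :=
  .mk (linearIndependent_monomial q.ne_zero) (span_range_monomial q).ge

theorem monomialBasis_apply (q : kˣ) (l : ℤ × ℤ) :
    monomialBasis q l = (monomial (q : k) l : QuantumTorus (q : k)) := by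
  simp [monomialBasis]

end QuantumTorus

/-! ### Structure constants of the model algebra -/

section TwistedBases

variable {k : Type*} [Field k]

theorem tensorGrading_span_singleton {G H A B : Type*} [Semiring A] [Algebra k A] [Semiring B]
    [Algebra k B] {𝓐 : G → Submodule k A} {𝓑 : H → Submodule k B} {p : G × H} {a : A} {b : B}
    (ha : 𝓐 p.1 = k ∙ a) (hb : 𝓑 p.2 = k ∙ b) : tensorGrading 𝓐 𝓑 p = k ∙ (a ⊗ₜ[k] b) := by
  rw [tensorGrading, ha, hb]
  apply le_antisymm <;> rw [Submodule.span_le]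
  · rintro _ ⟨x, hx, y, hy, rfl⟩
    obtain ⟨c, rfl⟩ := Submodule.mem_span_singleton.1 hx
    obtain ⟨d, rfl⟩ := Submodule.mem_span_singleton.1 hy
    rw [TensorProduct.smul_tmul_smul]
    exact Submodule.smul_mem _ _ (Submodule.mem_span_singleton_self _)
  · rintro _ rfl
    exact Submodule.subset_span ⟨a, Submodule.mem_span_singleton_self _, b,
      Submodule.mem_span_singleton_self _, rfl⟩

theorem piTensorGrading_span_singleton {ι : Type*} [Fintype ι] {G A : ι → Type*}
    [∀ i, Semiring (A i)] [∀ i, Algebra k (A i)] {𝓐 : ∀ i, G i → Submodule k (A i)} {g : ∀ i, G i}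
    {a : ∀ i, A i} (ha : ∀ i, 𝓐 i (g i) = k ∙ a i) :
    piTensorGrading 𝓐 g = k ∙ PiTensorProduct.tprod k a := by
  rw [piTensorGrading]
  simp only [ha]
  apply le_antisymm <;> rw [Submodule.span_le]
  · rintro _ ⟨x, hx, rfl⟩
    choose c hc using fun i => Submodule.mem_span_singleton.1 (hx i)
    obtain rfl : (fun i => c i • a i) = x := funext hc
    rw [MultilinearMap.map_smul_univ]
    exact Submodule.smul_mem _ _ (Submodule.mem_span_singleton_self _)
  · rintro _ rfl
    exact Submodule.subset_span ⟨a, fun i => Submodule.mem_span_singleton_self _, rfl⟩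

theorem laurentGrading_eq_span (s : ℕ) (p : Fin s → ℤ) :
    laurentGrading k s p = k ∙ (AddMonoidAlgebra.single p 1 : LaurentAlg k s) := by
  ext
  simp [Submodule.mem_span_singleton, AddMonoidAlgebra.mem_grade_iff']

/-- `ω` is the multiplication cocycle of `A` with respect to a basis whose elements span the
components of the grading. -/
def HasTwistedBasis {G A : Type*} [AddCommGroup G] [Semiring A] [Algebra k A]
    (𝓐 : G → Submodule k A) (ω : G → G → kˣ) : Prop :=
  ∃ t : Module.Basis G k A, t 0 = 1 ∧ (∀ g h, t g * t h = (ω g h : k) • t (g + h)) ∧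
    ∀ g, 𝓐 g = k ∙ t g

theorem HasTwistedBasis.tensor {G H A B : Type*} [AddCommGroup G] [AddCommGroup H] [Semiring A]
    [Algebra k A] [Semiring B] [Algebra k B] {𝓐 : G → Submodule k A} {𝓑 : H → Submodule k B}
    {ω : G → G → kˣ} {η : H → H → kˣ} (hA : HasTwistedBasis 𝓐 ω) (hB : HasTwistedBasis 𝓑 η) :
    HasTwistedBasis (tensorGrading 𝓐 𝓑) fun p p' => ω p.1 p'.1 * η p.2 p'.2 := by
  obtain ⟨t, ht0, ht, htA⟩ := hA
  obtain ⟨u, hu0, hu, huB⟩ := hB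
  have hbasis (p) : t.tensorProduct u p = t p.1 ⊗ₜ[k] u p.2 := t.tensorProduct_apply u p.1 p.2
  refine ⟨t.tensorProduct u, ?_, fun p p' => ?_, fun p => ?_⟩
  · rw [hbasis, Prod.fst_zero, Prod.snd_zero, ht0, hu0, Algebra.TensorProduct.one_def]
  · rw [hbasis, hbasis, hbasis, Algebra.TensorProduct.tmul_mul_tmul, ht, hu,
      TensorProduct.smul_tmul_smul, Units.val_mul, Prod.fst_add, Prod.snd_add]
  · rw [hbasis]
    exact tensorGrading_span_singleton (htA _) (huB _)

theorem HasTwistedBasis.piTensor {ι : Type*} [Fintype ι] {G A : ι → Type*}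
    [∀ i, AddCommGroup (G i)] [∀ i, Semiring (A i)] [∀ i, Algebra k (A i)]
    {𝓐 : ∀ i, G i → Submodule k (A i)} {ω : ∀ i, G i → G i → kˣ}
    (hA : ∀ i, HasTwistedBasis (𝓐 i) (ω i)) :
    HasTwistedBasis (piTensorGrading 𝓐) fun g h => ∏ i, ω i (g i) (h i) := by
  choose t ht0 ht htA using hA
  refine ⟨Basis.piTensorProduct t, ?_, fun g h => ?_, fun g => ?_⟩
  · simp only [Basis.piTensorProduct_apply, Pi.zero_apply, ht0]
    rfl
  · simp only [Basis.piTensorProduct_apply, PiTensorProduct.tprod_mul_tprod, Units.coe_prod]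
    rw [← MultilinearMap.map_smul_univ]
    congr 1
    ext1 i
    exact ht i _ _
  · rw [Basis.piTensorProduct_apply]
    exact piTensorGrading_span_singleton fun i => htA i (g i)

theorem hasTwistedBasis_quantumTorus (q : kˣ) :
    HasTwistedBasis (QuantumTorus.grading (q : k)) fun g h => q ^ (g.2 * h.1) := by
  refine ⟨QuantumTorus.monomialBasis q, ?_, fun g h => ?_, fun g => ?_⟩
  · rw [QuantumTorus.monomialBasis_apply, QuantumTorus.monomial_zero, Units.val_one]
  · simp only [QuantumTorus.monomialBasis_apply]
    exact QuantumTorus.monomial_mul q g h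
  · rw [QuantumTorus.monomialBasis_apply]
    rfl

theorem hasTwistedBasis_laurent (s : ℕ) : HasTwistedBasis (laurentGrading k s) 1 := by
  refine ⟨AddMonoidAlgebra.basis (Fin s → ℤ) k, ?_, fun g h => ?_, fun g => ?_⟩
  · simp [AddMonoidAlgebra.one_def]
  · simp [AddMonoidAlgebra.single_mul_single]
  · simpa using laurentGrading_eq_span s g

/-- The bimultiplicative cocycle of a tensor product of quantum tori. -/
def standardCocycle {r : ℕ} (q : Fin r → kˣ) (g h : Fin r → ℤ × ℤ) : kˣ :=
  ∏ i, q i ^ ((g i).2 * (h i).1)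

variable {r : ℕ} (q : Fin r → kˣ)

theorem standardCocycle_add_left (g g' h : Fin r → ℤ × ℤ) :
    standardCocycle q (g + g') h = standardCocycle q g h * standardCocycle q g' h := by
  simp [standardCocycle, add_mul, zpow_add, Finset.prod_mul_distrib]

theorem standardCocycle_add_right (g h h' : Fin r → ℤ × ℤ) :
    standardCocycle q g (h + h') = standardCocycle q g h * standardCocycle q g h' := by
  simp [standardCocycle, mul_add, zpow_add, Finset.prod_mul_distrib]

/-- The parameters `p i` are kept apart from the units `q i` so that powers of `ζ`, which are
elements of `k`, can be substituted. -/
theorem hasTwistedBasis_standard {p : Fin r → k} (hp : ∀ i, p i = q i) (s : ℕ) :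
    HasTwistedBasis (tensorGrading
      (piTensorGrading fun i => QuantumTorus.grading (p i)) (laurentGrading k s))
      fun g h => standardCocycle q g.1 h.1 := by
  obtain rfl : p = fun i => (q i : k) := funext hp
  simpa [standardCocycle] using
    (HasTwistedBasis.piTensor fun i => hasTwistedBasis_quantumTorus (q i)).tensor
      (hasTwistedBasis_laurent s)

end TwistedBases

/-! ### Symplectic normal form over the integers, modulo `N` -/

section AlternatingForms

open Module

/-- Appending a last entry, as an additive equivalence. -/
def snocAddEquiv (A : Type*) [AddCommGroup A] (r : ℕ) : A × (Fin r → A) ≃+ (Fin (r + 1) → A) :=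
  { Fin.snocEquiv fun _ => A with
    map_add' := by
      rintro ⟨a, f⟩ ⟨b, g⟩
      ext1 i
      refine Fin.lastCases ?_ (fun j => ?_) i <;> simp [Fin.snocEquiv] }

theorem snocAddEquiv_last {A : Type*} [AddCommGroup A] {r : ℕ} (p : A × (Fin r → A)) :
    snocAddEquiv A r p (Fin.last r) = p.1 := by
  simp [snocAddEquiv, Fin.snocEquiv]

theorem snocAddEquiv_castSucc {A : Type*} [AddCommGroup A] {r : ℕ} (p : A × (Fin r → A))
    (i : Fin r) : snocAddEquiv A r p i.castSucc = p.2 i := by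
  simp [snocAddEquiv, Fin.snocEquiv]

variable {Λ : Type*} [AddCommGroup Λ] {F : Λ →ₗ[ℤ] Λ →ₗ[ℤ] ℤ}

/-- Subtracting a multiple of `f` from `y` turns the remainder of `F e y` modulo `d` into a value of
`F`; being smaller than `d`, it is zero. -/
theorem dvd_apply_of_minimal {d : ℤ} (hd : 0 < d) (hmin : ∀ x y, 0 < F x y → d ≤ F x y)
    {e f : Λ} (hef : F e f = d) (y : Λ) : d ∣ F e y := by
  have h1 : F e (y - (F e y / d) • f) = F e y % d := by
    rw [map_sub, map_smul, hef, smul_eq_mul, Int.emod_def, mul_comm]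
  rw [Int.dvd_iff_emod_eq_zero]
  by_contra h
  have h2 := lt_of_le_of_ne (Int.emod_nonneg (F e y) hd.ne') (Ne.symm h)
  have h3 := hmin e (y - (F e y / d) • f) (h1 ▸ h2)
  have h4 := Int.emod_lt_of_pos (F e y) hd
  omega

theorem dvd_of_minimal (hF : F.IsAlt) {d : ℤ} (hd : 0 < d)
    (hmin : ∀ x y, 0 < F x y → d ≤ F x y) {e f : Λ} (hef : F e f = d) (x y : Λ) : d ∣ F x y := by
  obtain ⟨p, hp⟩ : d ∣ F x f := by
    have h := dvd_apply_of_minimal hd hmin (e := f) (f := -e) (by rw [map_neg, hF.neg, hef]) x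
    rwa [← hF.neg, dvd_neg] at h
  -- This translate of `x` pairs with `f` to exactly `d`, so it can play the role of `e`.
  have h1 := dvd_apply_of_minimal hd hmin (e := x - p • e + e) (f := f)
    (by simp [hp, hef, mul_comm]) y
  have h2 := dvd_apply_of_minimal hd hmin hef y
  have h3 : F x y = F (x - p • e + e) y + (p - 1) * F e y := by
    simp; ring
  rw [h3]
  exact dvd_add h1 (h2.mul_left _)

theorem exists_minimal_value (hF : F.IsAlt) {x₀ y₀ : Λ} (h₀ : F x₀ y₀ ≠ 0) :
    ∃ e f, 0 < F e f ∧ ∀ x y, F e f ∣ F x y := by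
  classical
  have hex : ∃ n : ℕ, 0 < n ∧ ∃ x y, F x y = n := by
    refine ⟨(F x₀ y₀).natAbs, Int.natAbs_pos.2 h₀, ?_⟩
    rcases Int.natAbs_eq (F x₀ y₀) with h | h
    · exact ⟨x₀, y₀, h⟩
    · exact ⟨y₀, x₀, by rw [← hF.neg]; omega⟩
  obtain ⟨hpos, e, f, hef⟩ := Nat.find_spec hex
  refine ⟨e, f, by omega, dvd_of_minimal hF (by omega) (fun x y hxy => ?_) rfl⟩
  rw [hef]
  have := Nat.find_min' hex (m := (F x y).toNat) ⟨by omega, x, y, by omega⟩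
  omega

/-- The submodule orthogonal to `e` and `f`. -/
def orthogonalPair (F : Λ →ₗ[ℤ] Λ →ₗ[ℤ] ℤ) (e f : Λ) : Submodule ℤ Λ :=
  LinearMap.ker (F e) ⊓ LinearMap.ker (F f)

/-- The map from the direct sum of `ℤe ⊕ ℤf` and its orthogonal complement. -/
def hyperbolicSplit (F : Λ →ₗ[ℤ] Λ →ₗ[ℤ] ℤ) (e f : Λ) :
    (ℤ × ℤ) × orthogonalPair F e f →ₗ[ℤ] Λ :=
  ((LinearMap.toSpanSingleton ℤ Λ e).coprod (LinearMap.toSpanSingleton ℤ Λ f)).coprod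
    (orthogonalPair F e f).subtype

theorem form_hyperbolicSplit (hF : F.IsAlt) (e f : Λ) (u v : (ℤ × ℤ) × orthogonalPair F e f) :
    F (hyperbolicSplit F e f u) (hyperbolicSplit F e f v) =
      F e f * (u.1.1 * v.1.2 - u.1.2 * v.1.1) + F u.2 v.2 := by
  obtain ⟨⟨a, b⟩, c, hc⟩ := u
  obtain ⟨⟨a', b'⟩, c', hc'⟩ := v
  obtain ⟨h1, h2⟩ : F e c = 0 ∧ F f c = 0 := by simpa [orthogonalPair] using hc
  obtain ⟨h1', h2'⟩ : F e c' = 0 ∧ F f c' = 0 := by simpa [orthogonalPair] using hc'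
  have h3 : F c e = 0 := by rw [← hF.neg, h1, neg_zero]
  have h4 : F c f = 0 := by rw [← hF.neg, h2, neg_zero]
  have h5 : F f e = -F e f := by rw [hF.neg]
  simp [hyperbolicSplit, h1', h2', h3, h4, hF.self_eq_zero, h5]
  ring

/-- Pairing with `e` and `f` recovers the two integer coordinates up to the nonzero factor `F e f`,
whence injectivity. Divisibility makes the projection coefficients `F x f / F e f` and `F e x / F e
f` integers, whence surjectivity. -/
theorem bijective_hyperbolicSplit (hF : F.IsAlt) {e f : Λ} (hd : 0 < F e f)
    (hdvd : ∀ x y, F e f ∣ F x y) : Function.Bijective (hyperbolicSplit F e f) := by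
  have h5 : F f e = -F e f := by rw [hF.neg]
  constructor
  · rw [← LinearMap.ker_eq_bot, LinearMap.ker_eq_bot']
    rintro u hu
    have h1 := form_hyperbolicSplit hF e f u ((1, 0), 0)
    have h2 := form_hyperbolicSplit hF e f u ((0, 1), 0)
    rw [hu] at h1 h2
    have hb : u.1.2 = 0 := by simpa [hd.ne'] using h1
    have ha : u.1.1 = 0 := by simpa [hd.ne'] using h2
    have hc : (u.2 : Λ) = 0 := by simpa [hyperbolicSplit, ha, hb] using hu
    exact Prod.ext (Prod.ext ha hb) (Subtype.ext hc)
  · intro x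
    obtain ⟨a, ha⟩ := hdvd x f
    obtain ⟨b, hb⟩ := hdvd e x
    have ha' : F f x = -(F e f * a) := by rw [← ha, hF.neg]
    refine ⟨((a, b), ⟨x - a • e - b • f, ?_⟩), ?_⟩
    · simp [orthogonalPair, hF.self_eq_zero, h5, hb, ha', mul_comm]
    · simp [hyperbolicSplit]

/-- Induction on the rank, splitting off a plane on which `F` takes its least positive value. That
every `d i` is a value of `F` is carried along so that the next, smaller coefficient is known to
divide it. -/
theorem exists_symplectic_coordinates_mod (N : ℤ) (n : ℕ) :
    ∀ {Λ : Type*} [AddCommGroup Λ] [Module.Free ℤ Λ] [Module.Finite ℤ Λ]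
      (F : Λ →ₗ[ℤ] Λ →ₗ[ℤ] ℤ), F.IsAlt → finrank ℤ Λ = n →
      ∃ (r s : ℕ) (ν : Λ ≃+ (Fin r → ℤ × ℤ) × (Fin s → ℤ)) (d : Fin r → ℤ),
        (∀ i, ¬ N ∣ d i) ∧ (∀ i j, i ≤ j → d j ∣ d i) ∧ (∀ i, ∃ x y, F x y = d i) ∧
        ∀ x y, N ∣ F x y -
          ∑ i, d i * (((ν x).1 i).1 * ((ν y).1 i).2 - ((ν x).1 i).2 * ((ν y).1 i).1) := by
  induction n using Nat.strong_induction_on with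
  | _ n ih =>
  intro Λ _ _ _ F hF hn
  by_cases hN : ∀ x y, N ∣ F x y
  · exact ⟨0, n, (finBasisOfFinrankEq ℤ Λ hn).equivFun.toAddEquiv.trans
      (AddEquiv.uniqueProd (M := Fin n → ℤ) (N := Fin 0 → ℤ × ℤ)).symm, Fin.elim0,
      fun i => i.elim0, fun i => i.elim0, fun i => i.elim0, by simpa using hN⟩
  push Not at hN
  obtain ⟨x₀, y₀, h₀⟩ := hN
  obtain ⟨e, f, hd, hdvd⟩ := exists_minimal_value hF (x₀ := x₀) (y₀ := y₀)
    (by rintro h; simp [h] at h₀)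
  set C := orthogonalPair F e f
  let g : ((ℤ × ℤ) × C) ≃ₗ[ℤ] Λ := .ofBijective _ (bijective_hyperbolicSplit hF hd hdvd)
  have hrank : 2 + finrank ℤ C = n := by
    rw [← hn, ← g.finrank_eq]; simp
  obtain ⟨r, s, ν, d, hNd, hdd, hval, hform⟩ := ih (finrank ℤ C) (by omega)
    (F.compl₁₂ C.subtype C.subtype) (fun x => hF x) rfl
  let ν' : Λ ≃+ (Fin (r + 1) → ℤ × ℤ) × (Fin s → ℤ) :=
    (g.symm.toAddEquiv.trans ((AddEquiv.refl _).prodCongr ν)).trans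
      (AddEquiv.prodAssoc.symm.trans ((snocAddEquiv _ r).prodCongr (AddEquiv.refl _)))
  have hν' (u) : (ν' (g u)).1 = snocAddEquiv _ r (u.1, (ν u.2).1) := by
    change snocAddEquiv _ r ((g.symm (g u)).1, (ν (g.symm (g u)).2).1) = _
    rw [g.symm_apply_apply]
  -- The new coefficient divides all the others and goes last: the orders of the corresponding roots
  -- of unity then increase along the list.
  refine ⟨r + 1, s, ν', Fin.snoc d (F e f), ?_, ?_, ?_, ?_⟩
  · intro i
    refine Fin.lastCases ?_ (fun j => ?_) i
    · simpa using fun h => h₀ (h.trans (hdvd _ _))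
    · simpa using hNd j
  · intro i j
    refine Fin.lastCases ?_ (fun j => ?_) j
    · intro _
      refine Fin.lastCases ?_ (fun i => ?_) i
      · simp
      · obtain ⟨x, y, hxy⟩ := hval i
        simp only [Fin.snoc_last, Fin.snoc_castSucc, ← hxy]
        exact hdvd _ _
    · refine Fin.lastCases ?_ (fun i => ?_) i
      · intro h
        exact absurd h (by simp [Fin.last_le_iff, Fin.castSucc_ne_last])
      · intro h
        simpa using hdd i j (by simpa using h)
  · intro i
    refine Fin.lastCases ⟨e, f, by simp⟩ (fun j => ?_) i
    obtain ⟨x, y, hxy⟩ := hval j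
    exact ⟨x, y, by simpa using hxy⟩
  · intro x y
    obtain ⟨u, rfl⟩ := g.surjective x
    obtain ⟨v, rfl⟩ := g.surjective y
    have h1 : F (g u) (g v) = _ := form_hyperbolicSplit hF e f u v
    have h2 := hform u.2 v.2
    simp only [LinearMap.compl₁₂_apply, Submodule.subtype_apply] at h2
    rw [h1, Fin.sum_univ_castSucc]
    convert h2 using 1
    simp only [hν', snocAddEquiv_last, snocAddEquiv_castSucc, Fin.snoc_last, Fin.snoc_castSucc]
    ring

end AlternatingForms

/-! ### Lifting root-of-unity forms to integral forms -/

section BimultiplicativeForms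

variable {k : Type*} [Field k] {Λ : Type*} [AddCommGroup Λ]

theorem exists_integral_lift [Module.Free ℤ Λ] [Module.Finite ℤ Λ] {c : Λ → Λ → kˣ}
    (hl : ∀ x x' y, c (x + x') y = c x y * c x' y) (hr : ∀ x y y', c x (y + y') = c x y * c x y')
    (hc : ∀ x, c x x = 1) {N : ℕ} [NeZero N] {ξ : kˣ} (hξ : IsPrimitiveRoot ξ N)
    (hN : ∀ x y, c x y ^ N = 1) :
    ∃ F : Λ →ₗ[ℤ] Λ →ₗ[ℤ] ℤ, F.IsAlt ∧ ∀ x y, c x y = ξ ^ F x y := by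
  let C : Λ →ₗ[ℤ] Λ →ₗ[ℤ] Additive kˣ := LinearMap.mk₂ ℤ (fun x y => Additive.ofMul (c x y))
    (fun x x' y => hl x x' y)
    (fun n x y => (AddMonoidHom.mk' (fun x => Additive.ofMul (c x y))
      fun x x' => hl x x' y).map_zsmul n x)
    (fun x y y' => hr x y y')
    (fun n x y => (AddMonoidHom.mk' (fun y => Additive.ofMul (c x y)) (hr x)).map_zsmul n y)
  have hC (x y) : C x y = Additive.ofMul (c x y) := rfl
  have hanti (x y) : c y x = (c x y)⁻¹ := by
    have := hc (x + y)
    rw [hl, hr, hr, hc, hc, one_mul, mul_one] at this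
    exact (inv_eq_of_mul_eq_one_right this).symm
  let b := Module.finBasis ℤ Λ
  have hpow (x y) : ∃ a : ℤ, ξ ^ a = c x y := by
    have hmem : c x y ∈ Subgroup.zpowers ξ := by
      rw [hξ.zpowers_eq]
      exact (mem_rootsOfUnity _ _).2 (hN x y)
    exact hmem
  choose a ha using hpow
  -- Exponents are chosen above the diagonal only; arbitrary choices for all pairs need not be
  -- antisymmetric, whereas `A - A.flip` is alternating.
  let A : Λ →ₗ[ℤ] Λ →ₗ[ℤ] ℤ := b.constr ℤ fun i => b.constr ℤ fun j =>
    if i < j then a (b i) (b j) else 0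
  have hA (i j) : A (b i) (b j) = if i < j then a (b i) (b j) else 0 := by
    rw [Module.Basis.constr_basis, Module.Basis.constr_basis]
  refine ⟨A - A.flip, fun x => by simp, ?_⟩
  have key : C = (A - A.flip).compr₂
      (LinearMap.toSpanSingleton ℤ (Additive kˣ) (Additive.ofMul ξ)) := by
    refine LinearMap.ext_basis b b fun i j => ?_
    simp only [LinearMap.compr₂_apply, LinearMap.sub_apply, LinearMap.flip_apply, hA,
      LinearMap.toSpanSingleton_apply, hC, ← ofMul_zpow]
    congr 1
    rcases lt_trichotomy i j with h | rfl | h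
    · simp [h, h.not_gt, ha]
    · simp [hc]
    · simp [h, h.not_gt, ha, hanti (b j) (b i)]
  intro x y
  exact congrArg Additive.toMul (LinearMap.congr_fun₂ key x y)

end BimultiplicativeForms

/-! ### The commutation factor of a torus -/

section Torus

variable {k : Type*} [Field k] {Λ : Type*} [AddCommGroup Λ] [DecidableEq Λ]
  {B : Type*} [Ring B] [Algebra k B] {𝓑 : Λ → Submodule k B} [GradedAlgebra 𝓑]

/-- The degree `-l` component of `u⁻¹` is already a right inverse of `u`, by comparing degree 0
parts in `u * u⁻¹ = 1`. -/
theorem inv_mem_neg {l : Λ} {u : Bˣ} (hu : (u : B) ∈ 𝓑 l) : ((u⁻¹ : Bˣ) : B) ∈ 𝓑 (-l) := by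
  have h := DirectSum.coe_decompose_mul_add_of_left_mem 𝓑 (j := -l) (b := ((u⁻¹ : Bˣ) : B)) hu
  rw [Units.mul_inv, add_neg_cancel,
    DirectSum.decompose_of_mem_same _ (SetLike.GradedOne.one_mem)] at h
  rw [Units.inv_eq_of_mul_eq_one_right h.symm]
  exact SetLike.coe_mem _

theorem IsAssocTorus.nontrivial [Nontrivial Λ] (h : IsAssocTorus 𝓑) : Nontrivial B := by
  by_contra hB
  rw [not_nontrivial_iff_subsingleton] at hB
  have h1 : gradedSupport 𝓑 = ∅ := by
    ext l
    simp [gradedSupport, Subsingleton.elim (𝓑 l) ⊥]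
  have h2 := h.closure_support
  rw [h1, AddSubgroup.closure_empty] at h2
  exact bot_ne_top h2

/-- Degrees of homogeneous units form a subgroup, so the support, which generates `Λ`, is all of it.
-/
theorem IsAssocTorus.exists_unit_mem (h : IsAssocTorus 𝓑) (l : Λ) :
    ∃ u : Bˣ, (u : B) ∈ 𝓑 l := by
  have hl : l ∈ AddSubgroup.closure (gradedSupport 𝓑) := h.closure_support ▸ AddSubgroup.mem_top l
  induction hl using AddSubgroup.closure_induction with
  | mem x hx =>
    obtain ⟨u, hu⟩ := h.spanned_by_unit x hx
    exact ⟨u, hu ▸ Submodule.mem_span_singleton_self _⟩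
  | zero => exact ⟨1, SetLike.GradedOne.one_mem⟩
  | add x y _ _ hx hy =>
    obtain ⟨u, hu⟩ := hx
    obtain ⟨v, hv⟩ := hy
    exact ⟨u * v, SetLike.mul_mem_graded hu hv⟩
  | neg x _ hx =>
    obtain ⟨u, hu⟩ := hx
    exact ⟨u⁻¹, inv_mem_neg hu⟩

theorem IsAssocTorus.eq_span_of_mem [Nontrivial B] (h : IsAssocTorus 𝓑) {l : Λ} {u : Bˣ}
    (hu : (u : B) ∈ 𝓑 l) : 𝓑 l = k ∙ (u : B) := by
  obtain ⟨w, hw⟩ := h.spanned_by_unit l fun h0 => by simp [h0] at hu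
  rw [hw] at hu ⊢
  obtain ⟨c, hc⟩ := Submodule.mem_span_singleton.1 hu
  have hc0 : c ≠ 0 := by
    rintro rfl
    exact u.ne_zero (by rw [← hc, zero_smul])
  rw [← hc, Submodule.span_singleton_smul_eq hc0.isUnit]

/-- `c` describes the commutation of homogeneous elements. -/
def IsCommutationFactor (𝓑 : Λ → Submodule k B) (c : Λ → Λ → kˣ) : Prop :=
  ∀ x y, ∀ a ∈ 𝓑 x, ∀ b ∈ 𝓑 y, a * b = (c x y : k) • (b * a)

theorem IsAssocTorus.exists_commutationFactor [Nontrivial B] (h : IsAssocTorus 𝓑) :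
    ∃ c, IsCommutationFactor 𝓑 c := by
  suffices ∀ x y, ∃ c : kˣ, ∀ a ∈ 𝓑 x, ∀ b ∈ 𝓑 y, a * b = (c : k) • (b * a) by
    choose c hc using this
    exact ⟨c, hc⟩
  intro x y
  obtain ⟨u, hu⟩ := h.exists_unit_mem x
  obtain ⟨v, hv⟩ := h.exists_unit_mem y
  have h1 : (u * v : B) ∈ 𝓑 (y + x) := add_comm x y ▸ SetLike.mul_mem_graded hu hv
  have h2 : ((v * u : Bˣ) : B) ∈ 𝓑 (y + x) := SetLike.mul_mem_graded hv hu
  rw [h.eq_span_of_mem h2] at h1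
  obtain ⟨c, hc⟩ := Submodule.mem_span_singleton.1 h1
  have hc0 : c ≠ 0 := by
    rintro rfl
    rw [zero_smul, ← Units.val_mul] at hc
    exact (u * v).ne_zero hc.symm
  refine ⟨Units.mk0 c hc0, fun a ha b hb => ?_⟩
  rw [h.eq_span_of_mem hu] at ha
  rw [h.eq_span_of_mem hv] at hb
  obtain ⟨α, rfl⟩ := Submodule.mem_span_singleton.1 ha
  obtain ⟨β, rfl⟩ := Submodule.mem_span_singleton.1 hb
  rw [Units.val_mul] at hc
  simp only [smul_mul_smul_comm, ← hc, Units.val_mk0, smul_smul]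
  congr 1
  ring

theorem scalar_eq_of_smul_unit_eq [Nontrivial B] (u : Bˣ) {c d : kˣ}
    (h : (c : k) • (u : B) = (d : k) • (u : B)) : c = d :=
  Units.ext (smul_left_injective k u.ne_zero h)

namespace IsCommutationFactor

variable {c : Λ → Λ → kˣ}

theorem self_eq_one [Nontrivial B] (h : IsAssocTorus 𝓑) (hc : IsCommutationFactor 𝓑 c) (x : Λ) :
    c x x = 1 := by
  obtain ⟨u, hu⟩ := h.exists_unit_mem x
  refine scalar_eq_of_smul_unit_eq (u * u) ?_
  rw [Units.val_mul, ← hc x x u hu u hu, Units.val_one, one_smul]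

theorem add_left [Nontrivial B] (h : IsAssocTorus 𝓑) (hc : IsCommutationFactor 𝓑 c) (x x' y : Λ) :
    c (x + x') y = c x y * c x' y := by
  obtain ⟨u, hu⟩ := h.exists_unit_mem x
  obtain ⟨u', hu'⟩ := h.exists_unit_mem x'
  obtain ⟨v, hv⟩ := h.exists_unit_mem y
  refine scalar_eq_of_smul_unit_eq (v * (u * u')) ?_
  rw [Units.val_mul, Units.val_mul, ← hc (x + x') y (u * u') (SetLike.mul_mem_graded hu hu') v hv,
    mul_assoc, hc x' y u' hu' v hv, mul_smul_comm, ← mul_assoc, hc x y u hu v hv, smul_mul_assoc,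
    smul_smul, mul_comm (c x y), Units.val_mul, mul_assoc]

theorem add_right [Nontrivial B] (h : IsAssocTorus 𝓑) (hc : IsCommutationFactor 𝓑 c) (x y y' : Λ) :
    c x (y + y') = c x y * c x y' := by
  obtain ⟨u, hu⟩ := h.exists_unit_mem x
  obtain ⟨v, hv⟩ := h.exists_unit_mem y
  obtain ⟨v', hv'⟩ := h.exists_unit_mem y'
  refine scalar_eq_of_smul_unit_eq (v * v' * u) ?_
  rw [Units.val_mul, Units.val_mul, ← hc x (y + y') u hu (v * v') (SetLike.mul_mem_graded hv hv'),
    ← mul_assoc, hc x y u hu v hv, smul_mul_assoc, mul_assoc, hc x y' u hu v' hv', mul_smul_comm,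
    smul_smul, Units.val_mul, mul_assoc]

/-- The radical of a commutation factor. -/
def radical [Nontrivial B] (h : IsAssocTorus 𝓑) (hc : IsCommutationFactor 𝓑 c) : AddSubgroup Λ where
  carrier := {x | ∀ y, c x y = 1}
  zero_mem' y := by simpa using hc.add_left h 0 0 y
  add_mem' hx hx' y := by rw [hc.add_left h, hx, hx', one_mul]
  neg_mem' {x} hx y := by
    have := hc.add_left h x (-x) y
    rw [hx, one_mul, add_neg_cancel] at this
    rw [← this]
    simpa using hc.add_left h 0 0 y

/-- Compare the components of degree `x + y` in `z * v = v * z`, for a unit `v` of degree `y`. -/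
theorem mem_radical_of_central [Nontrivial B] (h : IsAssocTorus 𝓑) (hc : IsCommutationFactor 𝓑 c)
    {z : B} (hz : ∀ b, z * b = b * z) {x : Λ} (hx : (DirectSum.decompose 𝓑 z x : B) ≠ 0) :
    x ∈ hc.radical h := by
  intro y
  obtain ⟨v, hv⟩ := h.exists_unit_mem y
  have h1 := DirectSum.coe_decompose_mul_add_of_right_mem 𝓑 (i := x) (a := z) hv
  have h2 := DirectSum.coe_decompose_mul_add_of_left_mem 𝓑 (j := x) (b := z) hv
  rw [hz, add_comm, h2, hc x y _ (SetLike.coe_mem _) v hv] at h1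
  have h3 : (v : B) * (DirectSum.decompose 𝓑 z x : B) ≠ 0 := by simpa using hx
  refine (Units.ext (smul_left_injective k h3 ?_)).symm
  simpa using h1

/-- A centroid element `χ` multiplies by the central element `χ 1`, so it moves degrees only within
cosets of the radical. The degrees of finitely many generators therefore meet every coset. -/
theorem finiteIndex_radical [Nontrivial B] (h : IsAssocTorus 𝓑) (hc : IsCommutationFactor 𝓑 c)
    (hfgc : IsFgc k B) : (hc.radical h).FiniteIndex := by
  classical
  obtain ⟨S, hS⟩ := hfgc.fg_top
  let s₀ : Finset Λ := S.biUnion fun b => (DirectSum.decompose 𝓑 b).support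
  -- Elements whose degrees lie in the cosets met by the generators.
  let W : Submodule (centroid k B) B :=
    { carrier := {b | ∀ x, (DirectSum.decompose 𝓑 b x : B) ≠ 0 → ∃ y ∈ s₀, x - y ∈ hc.radical h}
      zero_mem' := fun x hx => by simp at hx
      add_mem' := fun {a b} ha hb x hx => by
        by_cases h1 : (DirectSum.decompose 𝓑 a x : B) = 0
        · refine hb x fun h2 => hx ?_
          rw [DirectSum.decompose_add, DirectSum.add_apply, Submodule.coe_add, h1, h2, add_zero]
        · exact ha x h1
      smul_mem' := fun χ b hb x hx => by
        have hL (a b : B) : χ.1 (a * b) = a * χ.1 b :=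
          (LinearMap.congr_fun (Subalgebra.mem_centralizer_iff k |>.1 χ.2 (LinearMap.mulLeft k a)
            (Algebra.subset_adjoin (Or.inl ⟨a, rfl⟩))) b).symm
        have hR (a b : B) : χ.1 (a * b) = χ.1 a * b :=
          (LinearMap.congr_fun (Subalgebra.mem_centralizer_iff k |>.1 χ.2 (LinearMap.mulRight k b)
            (Algebra.subset_adjoin (Or.inr ⟨b, rfl⟩))) a).symm
        have hz (b : B) : χ.1 1 * b = b * χ.1 1 := by rw [← hR, ← hL, one_mul, mul_one]
        have hχ : χ • b = χ.1 1 * b := by rw [← hR, one_mul]; rfl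
        rw [hχ, DirectSum.decompose_mul, DirectSum.coe_mul_apply] at hx
        obtain ⟨⟨g, l⟩, hgl, hne⟩ := Finset.exists_ne_zero_of_sum_ne_zero hx
        obtain rfl : g + l = x := (Finset.mem_filter.1 hgl).2
        obtain ⟨y, hy, hly⟩ := hb l (right_ne_zero_of_mul hne)
        refine ⟨y, hy, ?_⟩
        rw [add_sub_assoc]
        exact add_mem (hc.mem_radical_of_central h hz (left_ne_zero_of_mul hne)) hly }
  have hW : W = ⊤ := by
    rw [eq_top_iff, ← hS, Submodule.span_le]
    intro b hb x hx
    refine ⟨x, Finset.mem_biUnion.2 ⟨b, hb, ?_⟩, by simp⟩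
    rw [DFinsupp.mem_support_iff]
    exact fun h0 => hx (by rw [h0]; rfl)
  have hsurj : Function.Surjective fun y : s₀ => (QuotientAddGroup.mk y.1 : Λ ⧸ hc.radical h) := by
    intro q
    obtain ⟨x, rfl⟩ := QuotientAddGroup.mk_surjective q
    obtain ⟨u, hu⟩ := h.exists_unit_mem x
    have hx : (u : B) ∈ W := hW ▸ Submodule.mem_top
    obtain ⟨y, hy, hxy⟩ := hx x (by rw [DirectSum.decompose_of_mem_same _ hu]; exact u.ne_zero)
    refine ⟨⟨y, hy⟩, QuotientAddGroup.eq.2 ?_⟩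
    rwa [neg_add_eq_sub]
  have := Finite.of_surjective _ hsurj
  exact AddSubgroup.finiteIndex_of_finite_quotient

theorem exists_pow_eq_one [Nontrivial B] (h : IsAssocTorus 𝓑) (hc : IsCommutationFactor 𝓑 c)
    (hfgc : IsFgc k B) : ∃ N : ℕ, N ≠ 0 ∧ ∀ x y, c x y ^ N = 1 := by
  refine ⟨(hc.radical h).index, (hc.finiteIndex_radical h hfgc).index_ne_zero, fun x y => ?_⟩
  have h1 : c ((hc.radical h).index • x) y = 1 := AddSubgroup.nsmul_index_mem (hc.radical h) x y
  have h2 := (AddMonoidHom.mk' (fun x => Additive.ofMul (c x y))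
    fun x x' => hc.add_left h x x' y).map_nsmul (hc.radical h).index x
  exact (congrArg Additive.toMul h2).symm.trans h1

end IsCommutationFactor

end Torus

/-! ### Untwisting: the commutation factor determines the torus -/

section HomogeneousUnits

variable {k : Type*} [Field k] {Λ : Type*} [AddCommGroup Λ] [DecidableEq Λ]
  {B : Type*} [Ring B] [Algebra k B] {𝓑 : Λ → Submodule k B} [GradedAlgebra 𝓑]

/-- Pairs of a degree and an invertible element of that degree. -/
abbrev HomogeneousUnits (𝓑 : Λ → Submodule k B) : Type _ := {p : Λ × Bˣ // (p.2 : B) ∈ 𝓑 p.1}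

/-- The homogeneous units form an abelian group when the multiplication is divided by a
bimultiplicative cocycle with the same commutators. -/
abbrev HomogeneousUnits.addCommGroup {c ω : Λ → Λ → kˣ} (hc : IsCommutationFactor 𝓑 c)
    (hl : ∀ x x' y, ω (x + x') y = ω x y * ω x' y) (hr : ∀ x y y', ω x (y + y') = ω x y * ω x y')
    (hω : ∀ x y, ω x y = c x y * ω y x) : AddCommGroup (HomogeneousUnits 𝓑) :=
  letI : Add (HomogeneousUnits 𝓑) := ⟨fun p p' =>
    ⟨(p.1.1 + p'.1.1, scalarUnit B (ω p.1.1 p'.1.1)⁻¹ * (p.1.2 * p'.1.2)), by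
      rw [val_scalarUnit_mul]
      exact Submodule.smul_mem _ _ (SetLike.mul_mem_graded p.2 p'.2)⟩⟩
  letI : Zero (HomogeneousUnits 𝓑) := ⟨⟨(0, 1), SetLike.GradedOne.one_mem⟩⟩
  letI : Neg (HomogeneousUnits 𝓑) := ⟨fun p =>
    ⟨(-p.1.1, scalarUnit B (ω (-p.1.1) p.1.1) * p.1.2⁻¹), by
      rw [val_scalarUnit_mul]
      exact Submodule.smul_mem _ _ (inv_mem_neg p.2)⟩⟩
  have hzero (y) : ω 0 y = 1 := by simpa using hl 0 0 y
  { AddGroup.ofLeftAxioms (G := HomogeneousUnits 𝓑)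
      (by
        rintro ⟨⟨x, u⟩, hu⟩ ⟨⟨y, v⟩, hv⟩ ⟨⟨z, w⟩, hw⟩
        refine Subtype.ext (Prod.ext (add_assoc x y z) ?_)
        change scalarUnit B (ω (x + y) z)⁻¹ * (scalarUnit B (ω x y)⁻¹ * (u * v) * w) =
          scalarUnit B (ω x (y + z))⁻¹ * (u * (scalarUnit B (ω y z)⁻¹ * (v * w)))
        rw [hl, hr, ← mul_assoc u, ← (scalarUnit_commute _ u).eq]
        simp only [← mul_assoc, ← map_mul, mul_inv]
        congr 4
        rw [mul_right_comm, mul_comm (ω x z)⁻¹, mul_right_comm])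
      (by
        rintro ⟨⟨x, u⟩, hu⟩
        refine Subtype.ext (Prod.ext (zero_add x) ?_)
        change scalarUnit B (ω 0 x)⁻¹ * (1 * u) = u
        simp [hzero])
      (by
        rintro ⟨⟨x, u⟩, hu⟩
        refine Subtype.ext (Prod.ext (neg_add_cancel x) ?_)
        change scalarUnit B (ω (-x) x)⁻¹ * (scalarUnit B (ω (-x) x) * u⁻¹ * u) = 1
        simp) with
    add_comm := by
      rintro ⟨⟨x, u⟩, hu⟩ ⟨⟨y, v⟩, hv⟩
      refine Subtype.ext (Prod.ext (add_comm x y) ?_)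
      change scalarUnit B (ω x y)⁻¹ * (u * v) = scalarUnit B (ω y x)⁻¹ * (v * u)
      -- The commutator of `u` and `v` cancels against that of `ω`, by `hω`.
      have huv : u * v = scalarUnit B (c x y) * (v * u) := by
        ext
        rw [val_scalarUnit_mul]
        exact hc x y u hu v hv
      rw [huv, ← mul_assoc, ← map_mul, hω x y, mul_inv_rev, inv_mul_cancel_right] }

/-- The degree map from the twisted abelian group of homogeneous units onto the free group `Λ`
splits; additivity of the splitting is the required product rule. -/
theorem exists_section_of_cocycle [Module.Free ℤ Λ] (h : IsAssocTorus 𝓑) {c ω : Λ → Λ → kˣ}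
    (hc : IsCommutationFactor 𝓑 c)
    (hl : ∀ x x' y, ω (x + x') y = ω x y * ω x' y) (hr : ∀ x y y', ω x (y + y') = ω x y * ω x y')
    (hω : ∀ x y, ω x y = c x y * ω y x) :
    ∃ σ : Λ → Bˣ, (∀ x, (σ x : B) ∈ 𝓑 x) ∧
      ∀ x y, (σ x * σ y : B) = (ω x y : k) • (σ (x + y) : B) := by
  let _ := HomogeneousUnits.addCommGroup hc hl hr hω
  let deg : HomogeneousUnits 𝓑 →+ Λ := AddMonoidHom.mk' (fun p => p.1.1) fun _ _ => rfl
  have hdeg : Function.Surjective deg.toIntLinearMap := fun x =>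
    let ⟨u, hu⟩ := h.exists_unit_mem x
    ⟨⟨(x, u), hu⟩, rfl⟩
  obtain ⟨τ, hτ⟩ := Module.projective_lifting_property deg.toIntLinearMap LinearMap.id hdeg
  have hτ' (x) : (τ x).1.1 = x := LinearMap.congr_fun hτ x
  refine ⟨fun x => (τ x).1.2, fun x => ?_, fun x y => ?_⟩
  · have := (τ x).2
    rwa [hτ' x] at this
  · change ((τ x).1.2 * (τ y).1.2 : B) = (ω x y : k) • ((τ (x + y)).1.2 : B)
    have h1 : (τ (x + y)).1.2 =
        scalarUnit B (ω (τ x).1.1 (τ y).1.1)⁻¹ * ((τ x).1.2 * (τ y).1.2) :=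
      congrArg (fun p => p.1.2) (map_add τ x y)
    rw [hτ', hτ'] at h1
    rw [h1, ← val_scalarUnit_mul, ← mul_assoc, ← map_mul, mul_inv_cancel, map_one, one_mul,
      Units.val_mul]

/-- A choice of an invertible element in each component is a basis. -/
def IsAssocTorus.basis [Nontrivial B] (h : IsAssocTorus 𝓑) {σ : Λ → Bˣ}
    (hσ : ∀ x, (σ x : B) ∈ 𝓑 x) : Module.Basis Λ k B :=
  .mk ((DirectSum.Decomposition.isInternal 𝓑).submodule_iSupIndep.linearIndependent 𝓑 hσ
    fun x => (σ x).ne_zero) (by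
    rw [← (DirectSum.Decomposition.isInternal 𝓑).submodule_iSup_eq_top, iSup_le_iff]
    intro x
    rw [h.eq_span_of_mem (hσ x), Submodule.span_singleton_le_iff_mem]
    exact Submodule.subset_span ⟨x, rfl⟩)

theorem IsAssocTorus.hasTwistedBasis [Nontrivial B] [Module.Free ℤ Λ] (h : IsAssocTorus 𝓑)
    {c ω : Λ → Λ → kˣ} (hc : IsCommutationFactor 𝓑 c)
    (hl : ∀ x x' y, ω (x + x') y = ω x y * ω x' y) (hr : ∀ x y y', ω x (y + y') = ω x y * ω x y')
    (hω : ∀ x y, ω x y = c x y * ω y x) : HasTwistedBasis 𝓑 ω := by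
  obtain ⟨σ, hσ, hmul⟩ := exists_section_of_cocycle h hc hl hr hω
  have hb (x) : h.basis hσ x = σ x := by simp [IsAssocTorus.basis]
  refine ⟨h.basis hσ, ?_, fun x y => by rw [hb, hb, hb, hmul], fun x => ?_⟩
  -- Since `ω 0 0 = 1`, the unit `σ 0` is idempotent, hence 1.
  · have h1 := hmul 0 0
    have h2 : ω 0 0 = 1 := by simpa using hl 0 0 0
    rw [h2, Units.val_one, one_smul, add_zero] at h1
    rw [hb, mul_eq_left.1 (Units.ext h1 : σ 0 * σ 0 = σ 0), Units.val_one]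
  · rw [hb, h.eq_span_of_mem (hσ x)]

theorem HasTwistedBasis.isogradedIso {G G' A A' : Type*} [AddCommGroup G] [AddCommGroup G']
    [Semiring A] [Algebra k A] [Semiring A'] [Algebra k A'] {𝓐 : G → Submodule k A}
    {𝓐' : G' → Submodule k A'} {ω : G' → G' → kˣ} (ν : G ≃+ G')
    (hA : HasTwistedBasis 𝓐 fun x y => ω (ν x) (ν y)) (hA' : HasTwistedBasis 𝓐' ω) :
    IsogradedIso 𝓐 𝓐' := by
  obtain ⟨b, hb0, hbmul, hb⟩ := hA
  obtain ⟨t, ht0, htmul, ht⟩ := hA'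
  let φ : A ≃ₗ[k] A' := b.equiv t ν.toEquiv
  have hφ (x) : φ (b x) = t (ν x) := b.equiv_apply x _ _
  have hφmul : (LinearMap.mul k A).compr₂ φ.toLinearMap =
      (LinearMap.mul k A').compl₁₂ φ.toLinearMap φ.toLinearMap := by
    refine LinearMap.ext_basis b b fun x y => ?_
    simp only [LinearMap.compr₂_apply, LinearMap.compl₁₂_apply, LinearMap.mul_apply',
      LinearEquiv.coe_coe, hφ, htmul, hbmul, map_smul, map_add]
  refine ⟨AlgEquiv.ofLinearEquiv φ (by rw [← hb0, hφ, map_zero, ht0])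
    fun x y => LinearMap.congr_fun₂ hφmul x y, ν, fun l => ?_⟩
  rw [hb, ht, Submodule.map_span, Set.image_singleton]
  exact congrArg (fun z => k ∙ z) (hφ l)

theorem standardCocycle_commutator {ξ : kˣ} {r : ℕ} (d : Fin r → ℤ) (g h : Fin r → ℤ × ℤ) :
    standardCocycle (fun i => ξ ^ (-d i)) g h =
      ξ ^ (∑ i, d i * ((g i).1 * (h i).2 - (g i).2 * (h i).1)) *
        standardCocycle (fun i => ξ ^ (-d i)) h g := by
  have hsum (f : Fin r → ℤ) : ξ ^ (∑ i, f i) = ∏ i, ξ ^ f i :=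
    congrArg Additive.toMul (map_sum (zmultiplesHom (Additive kˣ) (Additive.ofMul ξ)) f _)
  simp only [standardCocycle, ← zpow_mul, ← hsum, ← zpow_add, ← Finset.sum_add_distrib]
  congr 2
  ext i
  ring

end HomogeneousUnits

end AssocTori

end

/-! ### The classification -/

theorem mainTheorem12
    {k : Type*} [Field k] [IsAlgClosed k] [CharZero k]
    (ζ : ℕ → k) (hζ : ∀ m : ℕ, 1 ≤ m → IsPrimitiveRoot (ζ m) m)
    {Λ : Type*} [AddCommGroup Λ] [DecidableEq Λ] [Module.Free ℤ Λ] [Module.Finite ℤ Λ]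
    (n : ℕ) (hn : 1 ≤ n) (hrank : Module.finrank ℤ Λ = n)
    {B : Type*} [Ring B] [Algebra k B] (𝓑 : Λ → Submodule k B) [GradedAlgebra 𝓑]
    (htorus : AssocTori.IsAssocTorus 𝓑) (hfgc : AssocTori.IsFgc k B) :
    ∃ (r s : ℕ) (m : Fin r → ℕ) (e : Fin r → ℤ),
      n = 2 * r + s ∧
      (∀ i, 2 ≤ m i) ∧
      (∀ i j, i ≤ j → m i ∣ m j) ∧
      (∀ i, Int.gcd (e i) (m i) = 1) ∧
      AssocTori.IsogradedIso 𝓑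
        (AssocTori.tensorGrading
          (AssocTori.piTensorGrading
            fun i : Fin r => AssocTori.QuantumTorus.grading (ζ (m i) ^ e i))
          (AssocTori.laurentGrading k s)) := by
  -- Positive rank excludes the zero ring, whose empty support generates only the trivial group.
  have : Nontrivial Λ := Module.nontrivial_of_finrank_pos (R := ℤ) (by omega)
  have := htorus.nontrivial
  obtain ⟨c, hc⟩ := htorus.exists_commutationFactor
  obtain ⟨N, hN, hcN⟩ := hc.exists_pow_eq_one htorus hfgc
  have : NeZero N := ⟨hN⟩
  have hζN := hζ N (Nat.one_le_iff_ne_zero.2 hN)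
  obtain ⟨ξ, hξ⟩ : ∃ ξ : kˣ, IsPrimitiveRoot ξ N :=
    ⟨(hζN.isUnit hN).unit, IsPrimitiveRoot.coe_units_iff.1 hζN⟩
  obtain ⟨F, hF, hcF⟩ := AssocTori.exists_integral_lift (hc.add_left htorus)
    (hc.add_right htorus) (hc.self_eq_one htorus) hξ hcN
  obtain ⟨r, s, ν, d, hNd, hdd, -, hform⟩ :=
    AssocTori.exists_symplectic_coordinates_mod N n F hF hrank
  -- The sign comes from the convention `x₂ x₁ = q x₁ x₂`: the commutator of `x₁` with `x₂` is
  -- `q⁻¹`, which has to be `ξ ^ d i`.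
  let q : Fin r → kˣ := fun i => ξ ^ (-d i)
  have hq_one (i) : q i ≠ 1 := by
    simpa [q, hξ.zpow_eq_one_iff_dvd] using hNd i
  have hq_pow (i) : q i ^ N = 1 := by
    rw [← zpow_natCast, ← zpow_mul, mul_comm, zpow_mul, zpow_natCast, hξ.pow_eq_one, one_zpow]
  have horder (i) : 0 < orderOf (q i) :=
    orderOf_pos_iff.2 (isOfFinOrder_iff_pow_eq_one.2 ⟨N, Nat.pos_of_ne_zero hN, hq_pow i⟩)
  have hexp (i) : ∃ e : ℤ, Int.gcd e (orderOf (q i)) = 1 ∧ ζ (orderOf (q i)) ^ e = q i := by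
    have : NeZero (orderOf (q i)) := ⟨(horder i).ne'⟩
    obtain ⟨e, -, he, hqe⟩ := (hζ (orderOf (q i)) (horder i)).isPrimitiveRoot_iff.1
      (IsPrimitiveRoot.coe_units_iff.2 (IsPrimitiveRoot.orderOf (q i)))
    exact ⟨e, by simpa using he, by simpa using hqe⟩
  choose e he hqe using hexp
  refine ⟨r, s, fun i => orderOf (q i), e, ?_, fun i => ?_, fun i j hij => ?_, he, ?_⟩
  · rw [← hrank, ν.toIntLinearEquiv.finrank_eq]
    simp [Module.finrank_pi_fintype, mul_comm]
  · change 2 ≤ orderOf (q i)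
    have := orderOf_eq_one_iff.not.2 (hq_one i)
    have := horder i
    omega
  -- As `d j ∣ d i`, the root `q i` is a power of `q j`.
  · obtain ⟨t, ht⟩ := hdd i j hij
    refine orderOf_dvd_of_mem_zpowers ⟨t, ?_⟩
    simp only [q]
    rw [← zpow_mul, ht, neg_mul]
  · refine AssocTori.HasTwistedBasis.isogradedIso ν (htorus.hasTwistedBasis hc
      (fun x x' y => ?_) (fun x y y' => ?_) fun x y => ?_) (AssocTori.hasTwistedBasis_standard q hqe s)
    · rw [map_add, Prod.fst_add, AssocTori.standardCocycle_add_left]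
    · rw [map_add, Prod.fst_add, AssocTori.standardCocycle_add_right]
    rw [AssocTori.standardCocycle_commutator, hcF]
    congr 1
    -- Powers of `ξ` agree when the exponents agree modulo `N`, so a normal form modulo `N`
    -- suffices.
    rw [← mul_inv_eq_one, ← zpow_neg, ← zpow_add, hξ.zpow_eq_one_iff_dvd, ← dvd_neg]
    rw [neg_add_rev, neg_neg, ← sub_eq_add_neg]
    exact hform x y
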